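/- All Hilbert spaces are finite-dimensional, with fixed computational (orthonormal) bases; $\overline{\,\cdot\,}$ is entrywise complex conjugation in these bases. Let $\mathcal H_b=\mathcal H_{A_b}\otimes\mathcal H_{B_b}$ for $b\in\{1,2\}$, $\mathcal H_{\hat A}=\mathcal H_{A_1}\otimes\mathcal H_{A_2}$, $\mathcal H_{\hat B}=\mathcal H_{B_1}\otimes\mathcal H_{B_2}$. For Hilbert spaces $\mathcal K,\mathcal L$ let $\mathbf{SEP}(\mathcal K:\mathcal L)$ be the cone of finite sums $\sum_x|\Pi_x\rangle\langle\Pi_x|$ with product vectors $|\Pi_x\rangle\in\mathcal K\otimes\mathcal L$. The Schmidt rank $\mathrm{SR}(|\Xi\rangle)$ of a bipartite vector is the number of terms in its Schmidt decomposition; the Schmidt rank (Schmidt number) $\mathrm{SR}(E)$ of a positive semidefinite operator $E$ on a bipartite space is the least $r$ such that $E$ lies in the convex cone generated by the pure states $|\phi\rangle\langle\phi|$ with $\mathrm{SR}(|\phi\rangle)\le r$. A bipartite pure state is called maximally entangled if all its nonzero Schmidt coefficients are equal, i.e. if it has the form $\frac1{\sqrt d}\sum_{i=1}^d|a_i\rangle|b_i\rangle$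 with orthonormal families $(a_i)$, $(b_i)$, $d\ge1$. **Theorem 2.** Let $\{\mathcal E_m:L(\mathcal H_1)\to L(\mathcal H_2)\}_{m\in\Sigma}$ ($\Sigma$ finite) be a quantum instrument (completely positive maps whose sum is trace preserving), with Choi operators $E_m=\sum_{i,j}|i\rangle\langle j|\otimes\mathcal E_m(|i\rangle\langle j|)$, regarded also as operators on $\mathcal H_{\hat A}\otimes\mathcal H_{\hat B}\simeq\mathcal H_1\otimes\mathcal H_2$. Let $|\tau\rangle\in\mathcal H_{R_A}\otimes\mathcal H_{R_B}$ be a unit vector, and put $\tau=|\tau\rangle\langle\tau|$. Suppose that $\{\mathcal E_m\}$ is deterministically implementable by separable instruments assisted by $|\tau\rangle$, that is, there are $S_m\in\mathbf{SEP}(\mathcal H_{\hat A}\otimes\mathcal H_{R_A}:\mathcal H_{R_B}\otimes\mathcal H_{\hat B})$, $m\in\Sigma$, with $$\mathrm{Tr}_{R_AR_B}\big[S_m(I\otimes\overline{\tau})\big]=E_m\quad(m\in\Sigma),\qquad I-\sum_{m\in\Sigma}\mathrm{Tr}_{A_2B_2}S_m\in\mathbf{SEP}(\mathcal H_{A_1}\otimes\mathcal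 H_{R_A}:\mathcal H_{R_B}\otimes\mathcal H_{B_1}).$$ Then 1. $\mathrm{SR}(|\tau\rangle)\ge\mathrm{SR}(E_m)$ for all $m\in\Sigma$, where the Schmidt ranks are taken with respect to $R_A:R_B$ and $\hat A:\hat B$, respectively. 2. If there is an $m\in\Sigma$ such that $\mathrm{SR}(|\tau\rangle)=\mathrm{SR}(E_m)$ and $E_m=|V^\dagger\rangle\langle V^\dagger|$ with $|V^\dagger\rangle=\sum_i|i\rangle_1\otimes V^\dagger|i\rangle_1$ for an isometry $V:\mathcal H_2\to\mathcal H_1$, then $|\tau\rangle$ is maximally entangled. -/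

import Mathlib

open scoped ComplexOrder Matrix Kronecker

/-!
Every finite-dimensional Hilbert space carries a fixed computational basis, so it is
`EuclideanSpace ℂ X` for a finite index type `X`; the tensor product of `EuclideanSpace ℂ X` and
`EuclideanSpace ℂ Y` is `EuclideanSpace ℂ (X × Y)`, and operators are complex matrices.
-/

section BasicNotions

variable {X Y : Type*} [Fintype X] [Fintype Y]

/-- The operator `|v⟩⟨v|`. -/
def ketBra (v : EuclideanSpace ℂ X) : Matrix X X ℂ :=
  Matrix.of fun x x' => v x * star (v x')

/-- The product vector `|a⟩ ⊗ |b⟩`. -/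
noncomputable def tensorVec (a : EuclideanSpace ℂ X) (b : EuclideanSpace ℂ Y) :
    EuclideanSpace ℂ (X × Y) :=
  WithLp.toLp 2 fun p => a p.1 * b p.2

/-- The vector `|M⟩ = ∑ i, |i⟩ ⊗ M|i⟩` of a linear operator `M` from `EuclideanSpace ℂ X` to
`EuclideanSpace ℂ Y`. -/
noncomputable def opVec (M : Matrix Y X ℂ) : EuclideanSpace ℂ (X × Y) :=
  WithLp.toLp 2 fun p => M p.2 p.1

/-- The partial trace over the second tensor factor. -/
def partialTraceSnd (M : Matrix (X × Y) (X × Y) ℂ) : Matrix X X ℂ :=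
  Matrix.of fun x x' => ∑ y, M (x, y) (x', y)

/-- The separable cone of a bipartite space: finite sums of `|Π⟩⟨Π|` with `|Π⟩` a (not necessarily
normalized) product vector. -/
def SeparableCone (X Y : Type*) [Fintype X] [Fintype Y] : Set (Matrix (X × Y) (X × Y) ℂ) :=
  {S | ∃ (n : ℕ) (a : Fin n → EuclideanSpace ℂ X) (b : Fin n → EuclideanSpace ℂ Y),
    S = ∑ k, ketBra (tensorVec (a k) (b k))}

/-- The Schmidt rank of a bipartite vector, i.e. the rank of its coefficient matrix. -/
noncomputable def schmidtRank (v : EuclideanSpace ℂ (X × Y)) : ℕ :=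
  (Matrix.of fun (x : X) (y : Y) => v (x, y)).rank

/-- The Schmidt rank is the number of terms of any Schmidt decomposition. -/
theorem schmidtRank_eq_card {K : Type*} [Fintype K] [DecidableEq K]
    (v : EuclideanSpace ℂ (X × Y)) (p : K → ℝ) (hp : ∀ k, 0 < p k)
    (a : K → EuclideanSpace ℂ X) (b : K → EuclideanSpace ℂ Y)
    (ha : Orthonormal ℂ a) (hb : Orthonormal ℂ b)
    (hv : v = ∑ k, (p k : ℂ) • tensorVec (a k) (b k)) :
    schmidtRank v = Fintype.card K := by
  set P : Matrix X K ℂ := Matrix.of fun x k => a k x with hP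
  set Q : Matrix Y K ℂ := Matrix.of fun y k => b k y with hQ
  set D : Matrix K K ℂ := Matrix.diagonal fun k => (p k : ℂ) with hD
  have key : (Matrix.of fun (x : X) (y : Y) => v (x, y)) = P * D * Qᵀ := by
    ext x y
    simp [hv, hP, hQ, hD, Matrix.mul_apply, tensorVec, Matrix.diagonal_apply]
    refine Finset.sum_congr rfl fun k _ => by ring
  have hPP : Pᴴ * P = 1 := by
    ext i j
    have := orthonormal_iff_ite.mp ha i j
    simpa [hP, Matrix.mul_apply, Matrix.one_apply, PiLp.inner_apply, mul_comm] using this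
  have hQQ : Qᵀ * Qᴴᵀ = 1 := by
    rw [← Matrix.transpose_mul]
    have : Qᴴ * Q = 1 := by
      ext i j
      have := orthonormal_iff_ite.mp hb i j
      simpa [hQ, Matrix.mul_apply, Matrix.one_apply, PiLp.inner_apply, mul_comm] using this
    rw [this, Matrix.transpose_one]
  have hDr : D.rank = Fintype.card K := by
    rw [hD, Matrix.rank_of_det_ne_zero]
    rw [Matrix.det_diagonal]
    exact Finset.prod_ne_zero_iff.mpr fun k _ => by exact_mod_cast (hp k).ne'
  have hback : D = Pᴴ * (P * D * Qᵀ) * Qᴴᵀ := by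
    calc D = (Pᴴ * P) * D * (Qᵀ * Qᴴᵀ) := by rw [hPP, hQQ]; simp
      _ = _ := by simp only [Matrix.mul_assoc]
  unfold schmidtRank
  rw [key]
  apply le_antisymm
  · exact ((Matrix.rank_mul_le_left _ _).trans (Matrix.rank_mul_le_right _ _)).trans hDr.le
  · calc Fintype.card K = D.rank := hDr.symm
      _ = (Pᴴ * (P * D * Qᵀ) * Qᴴᵀ).rank := by rw [← hback]
      _ ≤ _ := (Matrix.rank_mul_le_left _ _).trans (Matrix.rank_mul_le_right _ _)

/-- The Schmidt rank (Schmidt number) of a positive semidefinite operator `E` on a bipartite space: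
the least `r` such that `E` lies in the convex cone generated by the pure states of Schmidt rank at
most `r` (the nonnegative weights are absorbed in the vectors). -/
noncomputable def schmidtNumber (E : Matrix (X × Y) (X × Y) ℂ) : ℕ :=
  sInf {r | ∃ (n : ℕ) (v : Fin n → EuclideanSpace ℂ (X × Y)),
    (∀ k, schmidtRank (v k) ≤ r) ∧ E = ∑ k, ketBra (v k)}

/-- A bipartite pure state is maximally entangled if all its nonzero Schmidt coefficients are
equal, i.e. if it is `(1/√d) ∑ i, |a i⟩ ⊗ |b i⟩` with orthonormal families `a` and `b` of some
length `d ≥ 1` (which is then its Schmidt rank). -/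
def IsMaximallyEntangled (v : EuclideanSpace ℂ (X × Y)) : Prop :=
  ∃ (d : ℕ) (a : Fin d → EuclideanSpace ℂ X) (b : Fin d → EuclideanSpace ℂ Y),
    0 < d ∧ Orthonormal ℂ a ∧ Orthonormal ℂ b ∧
      v = ((1 / Real.sqrt d : ℝ) : ℂ) • ∑ i, tensorVec (a i) (b i)

/-- Complete positivity: for every `n`, applying `F` to the blocks of a positive semidefinite
`n × n` block matrix gives a positive semidefinite matrix. -/
def IsCompletelyPositive (F : Matrix X X ℂ →ₗ[ℂ] Matrix Y Y ℂ) : Prop :=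
  ∀ (n : ℕ) (M : Matrix (Fin n × X) (Fin n × X) ℂ), M.PosSemidef →
    (Matrix.of fun (p q : Fin n × Y) =>
      F (Matrix.of fun x x' => M (p.1, x) (q.1, x')) p.2 q.2).PosSemidef

/-- A quantum instrument: completely positive maps whose sum preserves the trace. -/
def IsQuantumInstrument {ι : Type*} [Fintype ι]
    (F : ι → Matrix X X ℂ →ₗ[ℂ] Matrix Y Y ℂ) : Prop :=
  (∀ m, IsCompletelyPositive (F m)) ∧
    ∀ M : Matrix X X ℂ, (∑ m, F m M).trace = M.trace

/-- The Choi operator `∑ i j, |i⟩⟨j| ⊗ F(|i⟩⟨j|)`. -/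
def choi [DecidableEq X] (F : Matrix X X ℂ →ₗ[ℂ] Matrix Y Y ℂ) :
    Matrix (X × Y) (X × Y) ℂ :=
  ∑ i, ∑ j, Matrix.single i j (1 : ℂ) ⊗ₖ F (Matrix.single i j 1)

end BasicNotions

section Implementation

variable {A₁ B₁ A₂ B₂ RA RB : Type*}
  [Fintype A₁] [Fintype B₁] [Fintype A₂] [Fintype B₂] [Fintype RA] [Fintype RB]

/-- Reordering of tensor factors `(A₁ ⊗ B₁) ⊗ (A₂ ⊗ B₂) ≃ (A₁ ⊗ A₂) ⊗ (B₁ ⊗ B₂)`. -/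
def partyOrder (E : Matrix ((A₁ × B₁) × (A₂ × B₂)) ((A₁ × B₁) × (A₂ × B₂)) ℂ) :
    Matrix ((A₁ × A₂) × (B₁ × B₂)) ((A₁ × A₂) × (B₁ × B₂)) ℂ :=
  Matrix.reindex (Equiv.prodProdProdComm A₁ B₁ A₂ B₂) (Equiv.prodProdProdComm A₁ B₁ A₂ B₂) E

/-- `Tr_{R_A R_B} (S (I ⊗ conj |τ⟩⟨τ|))` for an operator `S` on
`(A₁ ⊗ A₂ ⊗ R_A) ⊗ (R_B ⊗ B₁ ⊗ B₂)`; an operator on `(A₁ ⊗ A₂) ⊗ (B₁ ⊗ B₂)`. The conjugate is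
taken entrywise in the computational basis. -/
def traceResource [DecidableEq A₁] [DecidableEq A₂] [DecidableEq B₁] [DecidableEq B₂]
    (S : Matrix (((A₁ × A₂) × RA) × (RB × (B₁ × B₂))) (((A₁ × A₂) × RA) × (RB × (B₁ × B₂))) ℂ)
    (τ : EuclideanSpace ℂ (RA × RB)) :
    Matrix ((A₁ × A₂) × (B₁ × B₂)) ((A₁ × A₂) × (B₁ × B₂)) ℂ :=
  let f : ((A₁ × A₂) × (B₁ × B₂)) × (RA × RB) → ((A₁ × A₂) × RA) × (RB × (B₁ × B₂)) :=
    fun p => ((p.1.1, p.2.1), (p.2.2, p.1.2))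
  partialTraceSnd (S.submatrix f f *
    ((1 : Matrix ((A₁ × A₂) × (B₁ × B₂)) ((A₁ × A₂) × (B₁ × B₂)) ℂ) ⊗ₖ (ketBra τ).map star))

/-- `Tr_{A₂ B₂} S` for an operator `S` on `(A₁ ⊗ A₂ ⊗ R_A) ⊗ (R_B ⊗ B₁ ⊗ B₂)`; an operator on
`(A₁ ⊗ R_A) ⊗ (R_B ⊗ B₁)`. -/
def traceOutput
    (S : Matrix (((A₁ × A₂) × RA) × (RB × (B₁ × B₂))) (((A₁ × A₂) × RA) × (RB × (B₁ × B₂))) ℂ) :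
    Matrix ((A₁ × RA) × (RB × B₁)) ((A₁ × RA) × (RB × B₁)) ℂ :=
  let f : ((A₁ × RA) × (RB × B₁)) × (A₂ × B₂) → ((A₁ × A₂) × RA) × (RB × (B₁ × B₂)) :=
    fun p => (((p.1.1.1, p.2.1), p.1.1.2), (p.1.2.1, (p.1.2.2, p.2.2)))
  partialTraceSnd (S.submatrix f f)

/-- The maps `E m` from operators on `A₁ ⊗ B₁` to operators on `A₂ ⊗ B₂` are deterministically
implementable by separable instruments assisted by the pure state `τ` on `R_A ⊗ R_B`: there are
separable operators `S m` (the Choi operators of the successful branches of a separable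
instrument) with `Tr_{R_A R_B} (S m · conj |τ⟩⟨τ|)` the Choi operator of `E m`, such that
`I - ∑ m, Tr_{A₂ B₂} (S m)` is separable. -/
def DeterministicallyImplementable [DecidableEq A₁] [DecidableEq A₂] [DecidableEq B₁]
    [DecidableEq B₂] [DecidableEq RA] [DecidableEq RB] {ι : Type*} [Fintype ι]
    (E : ι → Matrix (A₁ × B₁) (A₁ × B₁) ℂ →ₗ[ℂ] Matrix (A₂ × B₂) (A₂ × B₂) ℂ)
    (τ : EuclideanSpace ℂ (RA × RB)) : Prop :=
  ∃ S : ι →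
      Matrix (((A₁ × A₂) × RA) × (RB × (B₁ × B₂))) (((A₁ × A₂) × RA) × (RB × (B₁ × B₂))) ℂ,
    (∀ m, S m ∈ SeparableCone ((A₁ × A₂) × RA) (RB × (B₁ × B₂))) ∧
    (∀ m, traceResource (S m) τ = partyOrder (choi (E m))) ∧
    1 - ∑ m, traceOutput (S m) ∈ SeparableCone (A₁ × RA) (RB × B₁)

end Implementation

/-! ### Linear algebra of rank-one operators and rank factorizations. -/

section LinearAlgebra

variable {X Y : Type*} [Fintype X] [Fintype Y]

/-! Read product vectors as matrices: a branch `a ⊗ b` of a separable operator sends a resource with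
coefficient matrix `T` to the output with matrix `a T b` (`traceResource_sum_ketBra`). Ranks cannot
grow under such products, which is the first claim.

For the second, let `W` be the matrix of `|V†⟩`. Purity forces `a k * T * b k = c k • W` with `∑ |c
k|² = 1` (`exists_smul_of_sum_ketBra_eq`). The inputs `τ ⊗ V|j⟩` then saturate the bound by `1` on
the total effect, so up to conjugation they are fixed by it; pairing with an arbitrary `ω` gives `∑
conj (c k) a k ω b k = Tr(T† ω) W` (`sum_branches_eq_of_isometry`).

Since `rank W` is at least `r = rank T`, everything compresses to `r × r` matrices, where `G H = c`
implies `H G = c`. With `T = P Q` and `ω = P X Q`, taking traces yields `Tr X = r Tr(Q Q† X)` for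
all `X`, so `r Q Q† = 1`: all Schmidt coefficients agree
(`smul_mul_conjTranspose_eq_one_of_branches`). -/

theorem ketBra_posSemidef (v : EuclideanSpace ℂ X) : (ketBra v).PosSemidef := by
  have : ketBra v = Matrix.vecMulVec v (star (v : X → ℂ)) := by
    ext x y; simp [ketBra, Matrix.vecMulVec_apply]
  rw [this]
  exact Matrix.posSemidef_vecMulVec_self_star _

theorem SeparableCone.posSemidef {S : Matrix (X × Y) (X × Y) ℂ} (hS : S ∈ SeparableCone X Y) :
    S.PosSemidef := by
  obtain ⟨n, a, b, rfl⟩ := hS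
  exact Matrix.posSemidef_sum _ fun k _ => ketBra_posSemidef _

omit [Fintype X] in
theorem partialTraceSnd_posSemidef {M : Matrix (X × Y) (X × Y) ℂ} (hM : M.PosSemidef) :
    (partialTraceSnd M).PosSemidef := by
  have : partialTraceSnd M = ∑ y, M.submatrix (fun x => (x, y)) (fun x => (x, y)) := by
    ext x x'; simp [partialTraceSnd, Matrix.sum_apply]
  rw [this]
  exact Matrix.posSemidef_sum _ fun y _ => hM.submatrix _

/-- If a sum of rank-one positive operators is `|w⟩⟨w|`, every summand is a multiple of it. -/
theorem exists_smul_of_sum_ketBra_eq {K : Type*} [Fintype K] (φ : K → EuclideanSpace ℂ X)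
    {w : EuclideanSpace ℂ X} (hw : w ≠ 0) (h : ∑ k, ketBra (φ k) = ketBra w) :
    ∃ c : K → ℂ, (∀ k, φ k = c k • w) ∧ ∑ k, c k * star (c k) = 1 := by
  have hq (v z : EuclideanSpace ℂ X) :
      ∑ x, ∑ x', star (z x) * ketBra v x x' * z x' = (‖inner ℂ z v‖ ^ 2 : ℝ) := by
    have : (inner ℂ z v : ℂ) * inner ℂ v z = (‖inner ℂ z v‖ ^ 2 : ℝ) := by
      rw [← inner_conj_symm v z, Complex.mul_conj, Complex.normSq_eq_norm_sq]
    rw [← this, PiLp.inner_apply, PiLp.inner_apply, Finset.sum_mul_sum]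
    refine Finset.sum_congr rfl fun x _ => Finset.sum_congr rfl fun x' _ => ?_
    simp [ketBra]; ring
  -- Evaluating both sides at `z ⟂ w` makes a sum of nonnegative terms `|⟨z, φ k⟩|²` vanish, so each
  -- one does.
  have hz (z : EuclideanSpace ℂ X) (h0 : inner ℂ z w = 0) (k : K) : inner ℂ z (φ k) = 0 := by
    have hs : ∑ k, ‖inner ℂ z (φ k)‖ ^ 2 = 0 := by
      have := hq w z
      rw [← h, h0] at this
      have h2 : ∑ x, ∑ x', star (z x) * (∑ k, ketBra (φ k)) x x' * z x'
          = ∑ k, ∑ x, ∑ x', star (z x) * ketBra (φ k) x x' * z x' := by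
        simp_rw [Matrix.sum_apply, Finset.mul_sum, Finset.sum_mul]
        rw [Finset.sum_comm]
        refine (Finset.sum_congr rfl fun x _ => Finset.sum_comm).trans ?_
        rw [Finset.sum_comm]
        refine (Finset.sum_congr rfl fun x _ => Finset.sum_comm).trans ?_
        rw [Finset.sum_comm]
      rw [h2] at this
      simp_rw [hq] at this
      simp at this
      exact_mod_cast this
    have := (Finset.sum_eq_zero_iff_of_nonneg (fun _ _ => by positivity)).1 hs k (Finset.mem_univ k)
    simpa using this
  have hww : (inner ℂ w w : ℂ) ≠ 0 := inner_self_ne_zero.2 hw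
  have hc (k : K) : φ k = (inner ℂ w (φ k) / inner ℂ w w : ℂ) • w := by
    set z := φ k - (inner ℂ w (φ k) / inner ℂ w w : ℂ) • w with hzdef
    have h1 : inner ℂ w z = 0 := by
      rw [hzdef, inner_sub_right, inner_smul_right]; field_simp; ring
    have h1' : inner ℂ z w = 0 := inner_eq_zero_symm.1 h1
    have h2 : inner ℂ z z = (0 : ℂ) := by
      conv_lhs => rw [hzdef]
      rw [inner_sub_right, inner_smul_right, ← hzdef, hz z h1' k, h1']; simp
    exact sub_eq_zero.1 (inner_self_eq_zero.1 h2)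
  refine ⟨_, hc, ?_⟩
  -- One nonzero diagonal entry of `|w⟩⟨w|` suffices to normalize the weights.
  obtain ⟨x, hx⟩ : ∃ x, w x ≠ 0 := by
    by_contra! h0
    exact hw (by ext x; simpa using h0 x)
  have hxx := congrFun (congrFun h x) x
  rw [Matrix.sum_apply] at hxx
  have hne : w x * star (w x) ≠ 0 := mul_ne_zero hx (by simpa using hx)
  apply mul_right_cancel₀ hne
  rw [Finset.sum_mul, one_mul]
  refine Eq.trans (Finset.sum_congr rfl fun k _ => ?_) hxx
  conv_rhs => rw [hc k]
  simp [ketBra]; ring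

/-- The columns of `P` are an orthonormal basis of the range of `T`, so `P * Pᴴ` fixes that range
and `Q = Pᴴ * T` works. -/
theorem Matrix.exists_orthonormal_factorization [DecidableEq X] [DecidableEq Y]
    (T : Matrix X Y ℂ) :
    ∃ (P : Matrix X (Fin T.rank) ℂ) (Q : Matrix (Fin T.rank) Y ℂ), Pᴴ * P = 1 ∧ T = P * Q := by
  have hr : Module.finrank ℂ (LinearMap.range (Matrix.toEuclideanLin T)) = T.rank := by
    rw [Matrix.toEuclideanLin_eq_toLin_orthonormal, ← Matrix.rank_eq_finrank_range_toLin]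
  let e := (stdOrthonormalBasis ℂ (LinearMap.range (Matrix.toEuclideanLin T))).reindex
    (finCongr hr)
  let P : Matrix X (Fin T.rank) ℂ := Matrix.of fun x k => (e k : EuclideanSpace ℂ X) x
  refine ⟨P, Pᴴ * T, ?_, ?_⟩
  · ext i j
    have := orthonormal_iff_ite.mp e.orthonormal i j
    simpa [P, Matrix.mul_apply, Matrix.one_apply, PiLp.inner_apply, mul_comm] using this
  · ext x y
    let t : LinearMap.range (Matrix.toEuclideanLin T) :=
      ⟨Matrix.toEuclideanLin T (EuclideanSpace.single y 1), LinearMap.mem_range_self _ _⟩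
    have ht (x : X) : (t : EuclideanSpace ℂ X) x = T x y := by
      simp [t, Matrix.toLpLin_apply]
    have h1 := congrArg (fun v : LinearMap.range (Matrix.toEuclideanLin T) =>
      (v : EuclideanSpace ℂ X) x) (e.sum_repr' t)
    simp only [Submodule.coe_inner, PiLp.inner_apply, ht] at h1
    rw [← h1]
    simp [P, Matrix.mul_apply, mul_comm]

/-- Preimages of `r` independent vectors of the range form `U'`; then `W * U'` is injective and `U`
is a left inverse. This compresses the branches to square matrices. -/
theorem Matrix.exists_mul_mul_eq_one_of_le_rank [DecidableEq X] [DecidableEq Y]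
    (W : Matrix X Y ℂ) {r : ℕ} (hr : r ≤ W.rank) :
    ∃ (U : Matrix (Fin r) X ℂ) (U' : Matrix Y (Fin r) ℂ), U * W * U' = 1 := by
  obtain ⟨v, hv⟩ := exists_linearIndependent_of_le_finrank (R := ℂ)
    (M := LinearMap.range W.mulVecLin) hr
  choose x hx using fun i => (v i).2
  let U' : Matrix Y (Fin r) ℂ := Matrix.of fun y i => x i y
  have hli : LinearIndependent ℂ (W * U').col := by
    have : (W * U').col = fun i => ((v i : X → ℂ)) := by
      ext i y
      rw [← hx i]
      simp [U', Matrix.mul_apply, Matrix.mulVec, dotProduct]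
    rw [this]
    exact hv.map' (Submodule.subtype _) (Submodule.ker_subtype _)
  have hinj := Matrix.mulVec_injective_iff.2 hli
  obtain ⟨g, hg⟩ := LinearMap.exists_leftInverse_of_injective (W * U').mulVecLin
    (LinearMap.ker_eq_bot.2 hinj)
  refine ⟨LinearMap.toMatrix' g, U', ?_⟩
  have := congrArg LinearMap.toMatrix' hg
  rw [LinearMap.toMatrix'_comp] at this
  rw [Matrix.mul_assoc]
  rwa [← Matrix.toLin'_apply', LinearMap.toMatrix'_toLin', LinearMap.toMatrix'_id] at this

end LinearAlgebra

/-! ### Bipartite vectors as coefficient matrices. -/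

section CoefficientMatrix

variable {X Y : Type*}

/-- The coefficient matrix of a bipartite vector. -/
def coeffMatrix (v : EuclideanSpace ℂ (X × Y)) : Matrix X Y ℂ :=
  Matrix.of fun x y => v (x, y)

/-- The bipartite vector with a given coefficient matrix. -/
noncomputable def ofCoeffMatrix (M : Matrix X Y ℂ) : EuclideanSpace ℂ (X × Y) :=
  WithLp.toLp 2 fun p => M p.1 p.2

@[simp]
theorem coeffMatrix_ofCoeffMatrix (M : Matrix X Y ℂ) : coeffMatrix (ofCoeffMatrix M) = M := rfl

theorem schmidtRank_ofCoeffMatrix [Fintype X] [Fintype Y] (M : Matrix X Y ℂ) :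
    schmidtRank (ofCoeffMatrix M) = M.rank := rfl

/-- A bipartite vector whose coefficient matrix is a `1 / √d` multiple of a partial isometry of
rank `d` is maximally entangled. -/
theorem isMaximallyEntangled_of_factorization [Fintype X] [Fintype Y] {d : ℕ} (hd : 0 < d)
    (v : EuclideanSpace ℂ (X × Y)) (P : Matrix X (Fin d) ℂ) (Q : Matrix (Fin d) Y ℂ)
    (hv : coeffMatrix v = P * Q) (hP : Pᴴ * P = 1) (hQ : (d : ℂ) • (Q * Qᴴ) = 1) :
    IsMaximallyEntangled v := by
  have hs : ((Real.sqrt d : ℝ) : ℂ) * (Real.sqrt d : ℝ) = d := by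
    rw [← Complex.ofReal_mul, Real.mul_self_sqrt (by positivity)]; simp
  have hs0 : ((Real.sqrt d : ℝ) : ℂ) ≠ 0 := by
    intro h; rw [h] at hs; simp at hs; exact hd.ne (by exact_mod_cast hs)
  refine ⟨d, fun i => WithLp.toLp 2 fun x => P x i,
    fun i => WithLp.toLp 2 fun y => (Real.sqrt d : ℝ) * Q i y, hd, ?_, ?_, ?_⟩
  · rw [orthonormal_iff_ite]
    intro i j
    have := congrFun (congrFun hP i) j
    simpa [Matrix.mul_apply, Matrix.one_apply, PiLp.inner_apply, mul_comm] using this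
  · rw [orthonormal_iff_ite]
    intro i j
    have := congrFun (congrFun hQ j) i
    rw [Matrix.smul_apply, Matrix.mul_apply, Matrix.one_apply, smul_eq_mul, Finset.mul_sum,
      ← hs] at this
    simp_rw [@eq_comm _ j i] at this
    rw [← this, PiLp.inner_apply]
    refine Finset.sum_congr rfl fun y _ => ?_
    simp; ring
  · ext ⟨x, y⟩
    have := congrFun (congrFun hv x) y
    simp only [coeffMatrix, Matrix.of_apply] at this
    rw [this, Matrix.mul_apply]
    simp only [tensorVec, PiLp.smul_apply, WithLp.ofLp_sum, Finset.sum_apply, smul_eq_mul,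
      Finset.mul_sum]
    refine Finset.sum_congr rfl fun i _ => ?_
    push_cast
    field_simp

end CoefficientMatrix

/-! ### Action of product branches on the resource. -/

section Resource

variable {A₁ B₁ A₂ B₂ RA RB : Type*}
  [Fintype A₁] [Fintype B₁] [Fintype A₂] [Fintype B₂] [Fintype RA] [Fintype RB]

theorem traceResource_apply
    [DecidableEq A₁] [DecidableEq A₂] [DecidableEq B₁] [DecidableEq B₂]
    (S : Matrix (((A₁ × A₂) × RA) × (RB × (B₁ × B₂))) (((A₁ × A₂) × RA) × (RB × (B₁ × B₂))) ℂ)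
    (τ : EuclideanSpace ℂ (RA × RB)) (p q : (A₁ × A₂) × (B₁ × B₂)) :
    traceResource S τ p q = ∑ r : RA × RB, ∑ r' : RA × RB,
      S ((p.1, r.1), (r.2, p.2)) ((q.1, r'.1), (r'.2, q.2)) * (star (τ r') * τ r) := by
  unfold traceResource partialTraceSnd
  simp only [Matrix.of_apply]
  refine Finset.sum_congr rfl fun r _ => ?_
  rw [Matrix.mul_apply, Fintype.sum_prod_type, Finset.sum_eq_single q]
  · refine Finset.sum_congr rfl fun r' _ => ?_
    simp [ketBra]
  · intro b _ hb
    exact Finset.sum_eq_zero fun r' _ => by simp [hb]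
  · simp

/-- The conjugate on `τ` in the trace cancels the one in the pairing, so each branch contracts with
`τ` as a plain matrix product. -/
theorem traceResource_sum_ketBra
    [DecidableEq A₁] [DecidableEq A₂] [DecidableEq B₁] [DecidableEq B₂] {K : Type*} [Fintype K]
    (a : K → EuclideanSpace ℂ ((A₁ × A₂) × RA)) (b : K → EuclideanSpace ℂ (RB × (B₁ × B₂)))
    (τ : EuclideanSpace ℂ (RA × RB)) :
    traceResource (∑ k, ketBra (tensorVec (a k) (b k))) τ =
      ∑ k, ketBra (ofCoeffMatrix (coeffMatrix (a k) * coeffMatrix τ * coeffMatrix (b k))) := by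
  have hmul (k : K) (p : (A₁ × A₂) × (B₁ × B₂)) :
      ofCoeffMatrix (coeffMatrix (a k) * coeffMatrix τ * coeffMatrix (b k)) p =
        ∑ r : RA × RB, a k (p.1, r.1) * τ r * b k (r.2, p.2) := by
    simp only [ofCoeffMatrix, Matrix.mul_apply, coeffMatrix, Matrix.of_apply, Finset.sum_mul]
    rw [Fintype.sum_prod_type, Finset.sum_comm]
  ext p q
  rw [traceResource_apply, Matrix.sum_apply]
  simp only [Matrix.sum_apply, Finset.sum_mul]
  refine (Finset.sum_congr rfl fun r _ => Finset.sum_comm).trans ?_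
  rw [Finset.sum_comm]
  refine Finset.sum_congr rfl fun k _ => ?_
  simp only [ketBra, Matrix.of_apply, hmul, star_sum, Finset.sum_mul_sum]
  refine Finset.sum_congr rfl fun r _ => Finset.sum_congr rfl fun r' _ => ?_
  simp [tensorVec]; ring

/-- The sesquilinear form of `traceOutput` of a separable operator, at two inputs `ω ⊗ ξ` and
`ω' ⊗ ξ'`, is the sum of the overlaps of the outputs of the product branches. -/
theorem traceOutput_sum_ketBra {K : Type*} [Fintype K]
    (a : K → EuclideanSpace ℂ ((A₁ × A₂) × RA)) (b : K → EuclideanSpace ℂ (RB × (B₁ × B₂)))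
    (ω ω' : Matrix RA RB ℂ) (ξ ξ' : A₁ × B₁ → ℂ) :
    star (fun p : (A₁ × RA) × (RB × B₁) => star (ω p.1.2 p.2.1 * ξ (p.1.1, p.2.2))) ⬝ᵥ
      (traceOutput (∑ k, ketBra (tensorVec (a k) (b k))) *ᵥ
        fun p => star (ω' p.1.2 p.2.1 * ξ' (p.1.1, p.2.2))) =
      ∑ k, ∑ o : A₂ × B₂,
        (∑ i : A₁ × B₁, (coeffMatrix (a k) * ω * coeffMatrix (b k)) (i.1, o.1) (i.2, o.2) * ξ i) *
        star (∑ i : A₁ × B₁,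
          (coeffMatrix (a k) * ω' * coeffMatrix (b k)) (i.1, o.1) (i.2, o.2) * ξ' i) := by
  have hout (k : K) (o : A₂ × B₂) (ω : Matrix RA RB ℂ) (ξ : A₁ × B₁ → ℂ) :
      ∑ i : A₁ × B₁, (coeffMatrix (a k) * ω * coeffMatrix (b k)) (i.1, o.1) (i.2, o.2) * ξ i =
        ∑ p : (A₁ × RA) × (RB × B₁), a k ((p.1.1, o.1), p.1.2) * b k (p.2.1, (p.2.2, o.2)) *
          (ω p.1.2 p.2.1 * ξ (p.1.1, p.2.2)) := by
    simp only [Fintype.sum_prod_type, Matrix.mul_apply, coeffMatrix, Matrix.of_apply,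
      Finset.sum_mul]
    refine Finset.sum_congr rfl fun a₁ _ => ?_
    rw [Finset.sum_comm]
    refine (Finset.sum_congr rfl fun rb _ => Finset.sum_comm).trans ?_
    rw [Finset.sum_comm]
    refine Finset.sum_congr rfl fun ra _ => Finset.sum_congr rfl fun rb _ =>
      Finset.sum_congr rfl fun b₁ _ => by ring
  simp only [hout, star_sum, dotProduct, Matrix.mulVec, traceOutput,
    partialTraceSnd, Matrix.of_apply, Matrix.submatrix_apply, Matrix.sum_apply, Finset.mul_sum,
    Finset.sum_mul]
  have key (f : (A₁ × RA) × (RB × B₁) → (A₁ × RA) × (RB × B₁) → A₂ × B₂ → K → ℂ) :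
      ∑ p, ∑ q, ∑ o, ∑ k, f p q o k = ∑ k, ∑ o, ∑ q, ∑ p, f p q o k := by
    calc ∑ p, ∑ q, ∑ o, ∑ k, f p q o k
        = ∑ q, ∑ o, ∑ k, ∑ p, f p q o k := by
          rw [Finset.sum_comm]
          refine Finset.sum_congr rfl fun q _ => ?_
          rw [Finset.sum_comm]
          exact Finset.sum_congr rfl fun o _ => Finset.sum_comm
      _ = ∑ o, ∑ k, ∑ q, ∑ p, f p q o k := by
          rw [Finset.sum_comm]
          exact Finset.sum_congr rfl fun o _ => Finset.sum_comm
      _ = _ := Finset.sum_comm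
  rw [← key]
  refine Finset.sum_congr rfl fun p _ => Finset.sum_congr rfl fun q _ =>
    Finset.sum_congr rfl fun o _ => Finset.sum_congr rfl fun k _ => ?_
  simp [ketBra, tensorVec]; ring

omit [Fintype A₁] [Fintype B₁] [Fintype RA] [Fintype RB] in
theorem traceOutput_posSemidef
    {S : Matrix (((A₁ × A₂) × RA) × (RB × (B₁ × B₂))) (((A₁ × A₂) × RA) × (RB × (B₁ × B₂))) ℂ}
    (hS : S.PosSemidef) : (traceOutput S).PosSemidef :=
  partialTraceSnd_posSemidef (hS.submatrix _)

end Resource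

/-! ### Rigidity when the target is the adjoint of an isometry. -/

section ResourceIdentity

variable {A₁ B₁ A₂ B₂ RA RB : Type*}
  [Fintype A₁] [Fintype B₁] [Fintype A₂] [Fintype B₂] [Fintype RA] [Fintype RB]

/-- The coefficient matrix, with respect to `A₁ A₂ : B₁ B₂`, of the vector `opVec M`. -/
def partyMatrix (M : Matrix (A₂ × B₂) (A₁ × B₁) ℂ) : Matrix (A₁ × A₂) (B₁ × B₂) ℂ :=
  Matrix.of fun α β => M (α.2, β.2) (α.1, β.1)

omit [Fintype A₁] [Fintype B₁] [Fintype A₂] [Fintype B₂] in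
theorem partyOrder_ketBra_opVec (M : Matrix (A₂ × B₂) (A₁ × B₁) ℂ) :
    partyOrder (ketBra (opVec M)) = ketBra (ofCoeffMatrix (partyMatrix M)) := by
  ext p q
  simp [partyOrder, ketBra, opVec, ofCoeffMatrix, partyMatrix]

/-- If a separable operation with bounded total effect implements, from the resource `τ`, the
adjoint of an isometry `V` with weights summing to one, its effect with `τ` replaced by any `ω`
is, averaged over the branches, proportional to that of `τ`. -/
theorem sum_branches_eq_of_isometry [DecidableEq A₁] [DecidableEq B₁] [DecidableEq A₂]
    [DecidableEq B₂] [DecidableEq RA] [DecidableEq RB] {K : Type*} [Fintype K]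
    (a : K → EuclideanSpace ℂ ((A₁ × A₂) × RA)) (b : K → EuclideanSpace ℂ (RB × (B₁ × B₂)))
    (hD : (1 - traceOutput (∑ k, ketBra (tensorVec (a k) (b k)))).PosSemidef)
    (τ : Matrix RA RB ℂ) (hτ : (τᴴ * τ).trace = 1)
    (V : Matrix (A₁ × B₁) (A₂ × B₂) ℂ) (hV : Vᴴ * V = 1) (c : K → ℂ)
    (hc : ∑ k, c k * star (c k) = 1)
    (h : ∀ k, coeffMatrix (a k) * τ * coeffMatrix (b k) = c k • partyMatrix Vᴴ)
    (ω : Matrix RA RB ℂ) :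
    ∑ k, star (c k) • (coeffMatrix (a k) * ω * coeffMatrix (b k)) =
      (τᴴ * ω).trace • partyMatrix Vᴴ := by
  -- Choi effects act on conjugated inputs; hence the order of arguments is reversed in `hu`.
  let u (ω : Matrix RA RB ℂ) (ξ : A₁ × B₁ → ℂ) : (A₁ × RA) × (RB × B₁) → ℂ :=
    fun p => star (ω p.1.2 p.2.1 * ξ (p.1.1, p.2.2))
  have hu (ω ω' : Matrix RA RB ℂ) (ξ ξ' : A₁ × B₁ → ℂ) :
      star (u ω ξ) ⬝ᵥ u ω' ξ' = (ω'ᴴ * ω).trace * (star ξ' ⬝ᵥ ξ) := by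
    have hl : (ω'ᴴ * ω).trace = ∑ ra, ∑ rb, star (ω' ra rb) * ω ra rb := by
      rw [Finset.sum_comm]; rfl
    have hr : star ξ' ⬝ᵥ ξ = ∑ a₁, ∑ b₁, star (ξ' (a₁, b₁)) * ξ (a₁, b₁) :=
      Fintype.sum_prod_type _
    rw [hl, hr, mul_comm, Finset.sum_mul_sum]
    simp only [Finset.sum_mul_sum, dotProduct, Fintype.sum_prod_type]
    refine Finset.sum_congr rfl fun a₁ _ => Finset.sum_congr rfl fun ra _ => ?_
    rw [Finset.sum_comm]
    refine Finset.sum_congr rfl fun b₁ _ => Finset.sum_congr rfl fun rb _ => ?_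
    simp [u]; ring
  have hout (k : K) (o : A₂ × B₂) (ξ : A₁ × B₁ → ℂ) :
      ∑ i : A₁ × B₁, (coeffMatrix (a k) * τ * coeffMatrix (b k)) (i.1, o.1) (i.2, o.2) * ξ i =
        c k * (Vᴴ *ᵥ ξ) o := by
    simp only [h, partyMatrix, Matrix.smul_apply, Matrix.of_apply, Matrix.mulVec, dotProduct,
      Finset.mul_sum, smul_eq_mul, mul_assoc]
  set C := traceOutput (∑ k, ketBra (tensorVec (a k) (b k))) with hC
  -- `Vᴴ` maps column `j` of `V` to the basis vector `j`, so only the output `o = j` survives.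
  have hCV (j : A₂ × B₂) (ω : Matrix RA RB ℂ) (ξ : A₁ × B₁ → ℂ) :
      star (u ω ξ) ⬝ᵥ (C *ᵥ u τ (V.col j)) = ∑ k, star (c k) *
        ∑ i : A₁ × B₁, (coeffMatrix (a k) * ω * coeffMatrix (b k)) (i.1, j.1) (i.2, j.2) * ξ i := by
    rw [hC, traceOutput_sum_ketBra]
    refine Finset.sum_congr rfl fun k _ => ?_
    have hVj : Vᴴ *ᵥ V.col j = Pi.single j 1 := by
      rw [← Matrix.mulVec_single_one, Matrix.mulVec_mulVec, hV, Matrix.one_mulVec]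
    rw [Finset.sum_eq_single j]
    · rw [hout, hVj]; simp [mul_comm]
    · intro o _ ho
      rw [hout k o (V.col j), hVj]; simp [ho]
    · simp
  have hcol (j : A₂ × B₂) : star (V.col j) ⬝ᵥ V.col j = 1 := by
    have := congrFun (congrFun hV j) j
    simpa [Matrix.mul_apply, dotProduct] using this
  -- The form of `1 - C ≥ 0` at this vector is `1 - ∑ |c k|² = 0`, so the vector lies in the kernel.
  have hfix (j : A₂ × B₂) : C *ᵥ u τ (V.col j) = u τ (V.col j) := by
    have h0 : star (u τ (V.col j)) ⬝ᵥ ((1 - C) *ᵥ u τ (V.col j)) = 0 := by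
      rw [Matrix.sub_mulVec, Matrix.one_mulVec, dotProduct_sub, hu, hτ, hcol, hCV]
      simp_rw [hout]
      have hVj : (Vᴴ *ᵥ V.col j) j = 1 := by
        rw [← Matrix.mulVec_single_one, Matrix.mulVec_mulVec, hV, Matrix.one_mulVec]; simp
      simp_rw [hVj, mul_one, mul_comm (star (c _)), hc, sub_self]
    have := (hD.dotProduct_mulVec_zero_iff _).1 h0
    rw [Matrix.sub_mulVec, Matrix.one_mulVec, sub_eq_zero] at this
    exact this.symm
  ext α β
  have h1 := hCV (α.2, β.2) ω (Pi.single (α.1, β.1) 1)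
  rw [hfix, hu] at h1
  simp only [Matrix.sum_apply, Matrix.smul_apply, smul_eq_mul]
  simpa [Pi.single_apply, partyMatrix] using h1.symm

/-- If the resource `P * Q` is taken to multiples of a matrix `W` of rank at least `r` by branches
whose average sends every `ω` to a multiple of `W`, the rows of `√r • Q` are orthonormal. -/
theorem smul_mul_conjTranspose_eq_one_of_branches {K α β RA RB : Type*} [Fintype K] [Fintype α]
    [Fintype β] [Fintype RA] [Fintype RB] {r : ℕ}
    (a : K → Matrix α RA ℂ) (b : K → Matrix RB β ℂ) (W : Matrix α β ℂ) (c : K → ℂ)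
    (hc : ∑ k, c k * star (c k) = 1) (P : Matrix RA (Fin r) ℂ) (Q : Matrix (Fin r) RB ℂ)
    (hP : Pᴴ * P = 1) (h : ∀ k, a k * (P * Q) * b k = c k • W)
    (hω : ∀ ω : Matrix RA RB ℂ, ∑ k, star (c k) • (a k * ω * b k) = ((P * Q)ᴴ * ω).trace • W)
    (U : Matrix (Fin r) α ℂ) (U' : Matrix β (Fin r) ℂ) (hU : U * W * U' = 1) :
    (r : ℂ) • (Q * Qᴴ) = 1 := by
  -- A one-sided inverse of a square matrix is two-sided, so the factors may be swapped. The factor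
  -- `star (c k)` covers `c k = 0`, where the swapped product need not vanish.
  have hGH (k : K) : star (c k) • ((Q * b k * U') * (U * a k * P)) =
      (c k * star (c k)) • (1 : Matrix (Fin r) (Fin r) ℂ) := by
    have h1 : (U * a k * P) * (Q * b k * U') = c k • 1 := by
      rw [← hU, ← Matrix.smul_mul, ← Matrix.mul_smul, ← h k]
      simp only [Matrix.mul_assoc]
    by_cases h0 : c k = 0
    · simp [h0]
    · have h2 : ((c k)⁻¹ • (U * a k * P)) * (Q * b k * U') = 1 := by
        rw [Matrix.smul_mul, h1, smul_smul, inv_mul_cancel₀ h0, one_smul]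
      have h3 := mul_eq_one_comm.1 h2
      rw [Matrix.mul_smul] at h3
      rw [mul_comm, mul_smul, ← h3, smul_smul (c k), mul_inv_cancel₀ h0, one_smul]
  -- Take `ω = P * X * Q` in `hω`, compress by `U` and `U'`, and compute the trace in two ways; the
  -- factor `r` is the trace of `U * W * U' = 1`.
  have htr (X : Matrix (Fin r) (Fin r) ℂ) : X.trace = (((r : ℂ) • (Q * Qᴴ)) * X).trace := by
    have hl : (U * (∑ k, star (c k) • (a k * (P * X * Q) * b k)) * U').trace = X.trace := by
      calc (U * (∑ k, star (c k) • (a k * (P * X * Q) * b k)) * U').trace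
          = ∑ k, (X * (star (c k) • ((Q * b k * U') * (U * a k * P)))).trace := by
            rw [Matrix.mul_sum, Matrix.sum_mul, Matrix.trace_sum]
            refine Finset.sum_congr rfl fun k _ => ?_
            simp only [Matrix.mul_smul, Matrix.smul_mul, Matrix.trace_smul]
            rw [show U * (a k * (P * X * Q) * b k) * U' = (U * a k * P) * (X * (Q * b k * U')) by
              simp only [Matrix.mul_assoc], Matrix.trace_mul_comm, Matrix.mul_assoc X]
        _ = X.trace := by
            simp_rw [hGH, Matrix.mul_smul, Matrix.mul_one, Matrix.trace_smul, smul_eq_mul]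
            rw [← Finset.sum_mul, hc, one_mul]
    have hr : (((P * Q)ᴴ * (P * X * Q)).trace) = (Q * Qᴴ * X).trace := by
      rw [Matrix.conjTranspose_mul,
        show Qᴴ * Pᴴ * (P * X * Q) = Qᴴ * ((Pᴴ * P) * (X * Q)) by simp only [Matrix.mul_assoc],
        hP, Matrix.one_mul, Matrix.trace_mul_comm, Matrix.mul_assoc, Matrix.trace_mul_comm]
    rw [← hl, hω, Matrix.mul_smul, Matrix.smul_mul, hU, Matrix.trace_smul, Matrix.trace_one, hr,
      Matrix.smul_mul, Matrix.trace_smul, Fintype.card_fin, smul_eq_mul, smul_eq_mul, mul_comm]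
  exact (Matrix.ext_iff_trace_mul_right.2 fun X => by rw [← htr, one_mul])

end ResourceIdentity

/-! ### Both claims of the theorem. -/

theorem theorem2 {A₁ B₁ A₂ B₂ RA RB ι : Type*}
    [Fintype A₁] [DecidableEq A₁] [Fintype B₁] [DecidableEq B₁]
    [Fintype A₂] [DecidableEq A₂] [Fintype B₂] [DecidableEq B₂]
    [Fintype RA] [DecidableEq RA] [Fintype RB] [DecidableEq RB] [Fintype ι]
    (E : ι → Matrix (A₁ × B₁) (A₁ × B₁) ℂ →ₗ[ℂ] Matrix (A₂ × B₂) (A₂ × B₂) ℂ)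
    (hE : IsQuantumInstrument E)
    (τ : EuclideanSpace ℂ (RA × RB)) (hτ : ‖τ‖ = 1)
    (himp : DeterministicallyImplementable E τ) :
    (∀ m, schmidtNumber (partyOrder (choi (E m))) ≤ schmidtRank τ) ∧
    ((∃ m, schmidtRank τ = schmidtNumber (partyOrder (choi (E m))) ∧
        ∃ V : Matrix (A₁ × B₁) (A₂ × B₂) ℂ, Vᴴ * V = 1 ∧ choi (E m) = ketBra (opVec Vᴴ)) →
      IsMaximallyEntangled τ) := by
  classical
  obtain ⟨S, hS, hSE, hrest⟩ := himp
  refine ⟨fun m => ?_, ?_⟩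
  · obtain ⟨n, a, b, hab⟩ := hS m
    rw [← hSE m, hab, traceResource_sum_ketBra]
    refine Nat.sInf_le ⟨n, _, fun k => ?_, rfl⟩
    rw [schmidtRank_ofCoeffMatrix]
    exact (Matrix.rank_mul_le_left _ _).trans (Matrix.rank_mul_le_right _ _)
  · rintro ⟨m, hrank, V, hV, hEm⟩
    obtain ⟨n, a, b, hab⟩ := hS m
    have hT0 : coeffMatrix τ ≠ 0 := by
      intro h0
      have : τ = 0 := by
        ext p
        exact congrFun (congrFun h0 p.1) p.2
      simp [this] at hτ
    obtain ⟨P, Q, hP, hPQ⟩ := (coeffMatrix τ).exists_orthonormal_factorization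
    have hr : 0 < schmidtRank τ := by
      refine Nat.pos_of_ne_zero fun h0 => hT0 ?_
      have : IsEmpty (Fin (coeffMatrix τ).rank) := ⟨fun i => (i.2.trans_eq h0).not_ge i.1.zero_le⟩
      rw [hPQ]
      ext x y
      simp [Matrix.mul_apply]
    have hE' := hSE m
    rw [hEm, partyOrder_ketBra_opVec] at hE'
    have hle : schmidtRank τ ≤ (partyMatrix Vᴴ).rank := by
      rw [hrank, hEm, partyOrder_ketBra_opVec]
      exact Nat.sInf_le ⟨1, fun _ => ofCoeffMatrix (partyMatrix Vᴴ), fun _ => le_rfl, by simp⟩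
    have hw : ofCoeffMatrix (partyMatrix Vᴴ) ≠ 0 := by
      intro h0
      have h1 : partyMatrix Vᴴ = 0 := by
        rw [← coeffMatrix_ofCoeffMatrix (partyMatrix Vᴴ), h0]; rfl
      rw [h1, Matrix.rank_zero] at hle
      omega
    rw [hab, traceResource_sum_ketBra] at hE'
    obtain ⟨c, hφ, hc⟩ := exists_smul_of_sum_ketBra_eq _ hw hE'
    have h (k) : coeffMatrix (a k) * coeffMatrix τ * coeffMatrix (b k) = c k • partyMatrix Vᴴ :=
      congrArg coeffMatrix (hφ k)
    have hD : (1 - traceOutput (∑ k, ketBra (tensorVec (a k) (b k)))).PosSemidef := by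
      rw [← hab]
      -- The other outcomes contribute positive operators, so the bound on the total effect holds
      -- for outcome `m` alone.
      have : 1 - traceOutput (S m) =
          (1 - ∑ m, traceOutput (S m)) + ∑ m' ∈ Finset.univ.erase m, traceOutput (S m') := by
        rw [← Finset.add_sum_erase _ _ (Finset.mem_univ m)]; abel
      rw [this]
      exact (SeparableCone.posSemidef hrest).add (Matrix.posSemidef_sum _ fun m' _ =>
        traceOutput_posSemidef (SeparableCone.posSemidef (hS m')))
    have hτ' : ((coeffMatrix τ)ᴴ * coeffMatrix τ).trace = 1 := by
      have h2 : (inner ℂ τ τ : ℂ) = 1 := by rw [inner_self_eq_norm_sq_to_K, hτ]; simp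
      rw [← h2, PiLp.inner_apply, Fintype.sum_prod_type, Finset.sum_comm]
      simp [Matrix.trace, Matrix.mul_apply, coeffMatrix, Complex.conj_mul']
    obtain ⟨U, U', hU⟩ := Matrix.exists_mul_mul_eq_one_of_le_rank _ hle
    refine isMaximallyEntangled_of_factorization hr τ P Q hPQ hP ?_
    refine smul_mul_conjTranspose_eq_one_of_branches _ _ _ c hc P Q hP
      (fun k => hPQ ▸ h k) (fun ω => ?_) U U' hU
    rw [← hPQ]
    exact sum_branches_eq_of_isometry a b hD _ hτ' V hV c hc h ω
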